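/- For complex numbers $a,q$ with $|q|<1$ and integers $n\ge 0$ write $(a;q)_n=\prod_{j=0}^{n-1}(1-aq^j)$ and $(a;q)_\infty=\prod_{j=0}^{\infty}(1-aq^j)$. For every complex $q$ with $|q|<1$ the series $\sum_{n\ge 1}q^{2n}(q^{n+1};q)_\infty^3\,(q^n;q)_n$ and the infinite products in it converge, and there is a unique sequence of integers $(D'(n))_{n\ge 1}$ such that, for all complex $q$ with $|q|<1$, $$\sum_{n=1}^\infty D'(n)q^n=\sum_{n=1}^\infty q^{2n}(q^{n+1};q)_\infty^3\,(q^n;q)_n .$$ For this sequence, which is also the only sequence of complex numbers with this property, and for all complex $q$ with $|q|<1$, $$\sum_{n=1}^\infty D'(n)q^{8n+2}=2\sum_{r,n=0}^\infty(-1)^n q^{(2r+1)^2+(2r+1+2n)^2}-\sum_{n=0}^\infty(-1)^n(n+1)q^{1+(2n+1)^2}-\sum_{n=0}^\infty q^{2(2n+1)^2},$$ where all the series converge absolutely. -/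

import Mathlib

noncomputable section

/-- The finite `q`-shifted factorial `(a;q)_n = ∏_{j=0}^{n-1} (1 - a q^j)`. -/
def qPoch (a q : ℂ) (n : ℕ) : ℂ := ∏ j ∈ Finset.range n, (1 - a * q ^ j)

/-- The infinite `q`-shifted factorial `(a;q)_∞ = ∏_{j=0}^∞ (1 - a q^j)`. -/
def qPochInf (a q : ℂ) : ℂ := ∏' j : ℕ, (1 - a * q ^ j)

/-- The summand `q^{2n} (q^{n+1};q)_∞^3 (q^n;q)_n`. -/
def dTerm (q : ℂ) (n : ℕ+) : ℂ :=
  q ^ (2 * (n : ℕ)) * qPochInf (q ^ ((n : ℕ) + 1)) q ^ 3 * qPoch (q ^ (n : ℕ)) q (n : ℕ)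

/-- `D` is the coefficient sequence of the series:
`∑_{n ≥ 1} D(n) q^n = ∑_{n ≥ 1} q^{2n} (q^{n+1};q)_∞^3 (q^n;q)_n` for all complex `|q| < 1`. -/
def IsDSeq (D : ℕ+ → ℂ) : Prop :=
  ∀ q : ℂ, ‖q‖ < 1 → HasSum (fun n : ℕ+ => D n * q ^ (n : ℕ)) (∑' n : ℕ+, dTerm q n)

end

open Filter Topology

noncomputable section

/-! Write θ for `partialTheta q` and S(a,c) for `awSum q a c`. The heart is the closed form θ² - ∑
(-1)^n (n+1) q^{n(n+1)/2} of the defining series (`hasSum_dTerm`).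

Telescoping gives S(a,c) + a S(aq,c) + cq S(a,cq) + acq S(aq,cq) = 1 (`awSum_functional_equation`).
Iterating in c, then in a, yields S(1,1) + S(q,1) = θ and S(q,1) = θ². For n ≥ 1 the summand `dTerm
q n` is half the difference of the n-th terms of S(q,1) and S(1,1). The n = 0 terms leave a
correction (q;q)_∞^3 / 2, which Jacobi's identity (`tsum_jacobi`) expands.

Replacing q by q^8 and multiplying by q^2 turns triangular numbers into odd squares. Folding the
symmetric double series θ² along its diagonal (`tsum_add_tsum_diag`) gives the stated right-hand
side. Integrality is read off the closed form; uniqueness is that of power series coefficients. -/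

/-! ### Convergence and bounds for q-shifted factorials -/

theorem summable_norm_mul_pow {q : ℂ} (hq : ‖q‖ < 1) (a : ℂ) :
    Summable (fun j : ℕ => ‖-(a * q ^ j)‖) := by
  simpa [norm_mul, norm_pow] using
    (summable_geometric_of_lt_one (norm_nonneg q) hq).mul_left ‖a‖

theorem multipliable_qPochInf {q : ℂ} (hq : ‖q‖ < 1) (a : ℂ) :
    Multipliable (fun j : ℕ => 1 - a * q ^ j) := by
  simpa [sub_eq_add_neg] using multipliable_one_add_of_summable (summable_norm_mul_pow hq a)

theorem tendsto_qPoch {q : ℂ} (hq : ‖q‖ < 1) (a : ℂ) :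
    Tendsto (fun n => qPoch a q n) atTop (𝓝 (qPochInf a q)) :=
  (multipliable_qPochInf hq a).hasProd.tendsto_prod_nat

theorem qPoch_zero (a q : ℂ) : qPoch a q 0 = 1 := by simp [qPoch]

theorem qPoch_succ (a q : ℂ) (n : ℕ) : qPoch a q (n + 1) = qPoch a q n * (1 - a * q ^ n) :=
  Finset.prod_range_succ _ _

theorem qPoch_succ' (a q : ℂ) (n : ℕ) : qPoch a q (n + 1) = (1 - a) * qPoch (a * q) q n := by
  simp only [qPoch, Finset.prod_range_succ', pow_zero, mul_one, pow_succ']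
  rw [mul_comm]
  simp only [mul_assoc]

theorem qPochInf_step {q : ℂ} (hq : ‖q‖ < 1) (a : ℂ) :
    qPochInf a q = (1 - a) * qPochInf (a * q) q := by
  refine tendsto_nhds_unique ((tendsto_qPoch hq a).comp (tendsto_add_atTop_nat 1)) ?_
  refine ((tendsto_qPoch hq (a * q)).const_mul (1 - a)).congr fun n => ?_
  simp [qPoch_succ']

/-- The bound is uniform in `n` and tends to 0 with `a`, so it serves both for domination and for
limits in which the length varies too. -/
theorem norm_qPoch_sub_one_le {q : ℂ} (hq : ‖q‖ < 1) (a : ℂ) (n : ℕ) :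
    ‖qPoch a q n - 1‖ ≤ Real.exp (‖a‖ / (1 - ‖q‖)) - 1 := by
  have h := Finset.norm_prod_one_add_sub_one_le (Finset.range n) (fun j => -(a * q ^ j))
  have h2 : ∑ j ∈ Finset.range n, ‖-(a * q ^ j)‖ ≤ ‖a‖ / (1 - ‖q‖) := by
    refine ((summable_norm_mul_pow hq a).sum_le_tsum _ fun _ _ => norm_nonneg _).trans_eq ?_
    simp [norm_pow, tsum_mul_left, tsum_geometric_of_lt_one (norm_nonneg q) hq,
      div_eq_mul_inv]
  simp only [← sub_eq_add_neg] at h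
  exact h.trans (by gcongr)

theorem norm_qPochInf_sub_one_le {q : ℂ} (hq : ‖q‖ < 1) (a : ℂ) :
    ‖qPochInf a q - 1‖ ≤ Real.exp (‖a‖ / (1 - ‖q‖)) - 1 :=
  le_of_tendsto ((tendsto_qPoch hq a).sub_const 1).norm
    (Eventually.of_forall (norm_qPoch_sub_one_le hq a))

theorem norm_le_of_norm_sub_one_le {x : ℂ} {r : ℝ} (h : ‖x - 1‖ ≤ r - 1) : ‖x‖ ≤ r := by
  have := norm_add_le (x - 1) 1
  simp only [sub_add_cancel, norm_one] at this
  linarith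

/-- A bound for all the `q`-shifted factorials `(a;q)_n` with `‖a‖ ≤ 1`. -/
def qPochBound (q : ℂ) : ℝ := Real.exp (1 / (1 - ‖q‖))

theorem qPochBound_pos (q : ℂ) : 0 < qPochBound q := Real.exp_pos _

theorem exp_le_qPochBound {q a : ℂ} (hq : ‖q‖ < 1) (ha : ‖a‖ ≤ 1) :
    Real.exp (‖a‖ / (1 - ‖q‖)) ≤ qPochBound q := by
  have : 0 < 1 - ‖q‖ := by linarith
  unfold qPochBound
  gcongr

theorem norm_qPoch_le {q a : ℂ} (hq : ‖q‖ < 1) (ha : ‖a‖ ≤ 1) (n : ℕ) :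
    ‖qPoch a q n‖ ≤ qPochBound q :=
  (norm_le_of_norm_sub_one_le (norm_qPoch_sub_one_le hq a n)).trans (exp_le_qPochBound hq ha)

theorem norm_qPochInf_le {q a : ℂ} (hq : ‖q‖ < 1) (ha : ‖a‖ ≤ 1) :
    ‖qPochInf a q‖ ≤ qPochBound q :=
  (norm_le_of_norm_sub_one_le (norm_qPochInf_sub_one_le hq a)).trans (exp_le_qPochBound hq ha)

theorem tendsto_exp_norm_sub_one {q : ℂ} {a : ℕ → ℂ} (ha : Tendsto a atTop (𝓝 0)) :
    Tendsto (fun N => Real.exp (‖a N‖ / (1 - ‖q‖)) - 1) atTop (𝓝 0) := by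
  have h := ((Real.continuous_exp.tendsto _).comp (ha.norm.div_const (1 - ‖q‖))).sub_const 1
  simpa [Function.comp_def] using h

theorem tendsto_qPoch_one {q : ℂ} (hq : ‖q‖ < 1) {a : ℕ → ℂ} (ha : Tendsto a atTop (𝓝 0))
    (m : ℕ → ℕ) : Tendsto (fun N => qPoch (a N) q (m N)) atTop (𝓝 1) := by
  rw [tendsto_iff_norm_sub_tendsto_zero]
  exact squeeze_zero (fun _ => norm_nonneg _) (fun N => norm_qPoch_sub_one_le hq (a N) (m N))
    (tendsto_exp_norm_sub_one ha)

theorem tendsto_qPochInf_one {q : ℂ} (hq : ‖q‖ < 1) {a : ℕ → ℂ} (ha : Tendsto a atTop (𝓝 0)) :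
    Tendsto (fun N => qPochInf (a N) q) atTop (𝓝 1) := by
  rw [tendsto_iff_norm_sub_tendsto_zero]
  exact squeeze_zero (fun _ => norm_nonneg _) (fun N => norm_qPochInf_sub_one_le hq (a N))
    (tendsto_exp_norm_sub_one ha)

/-! ### The Andrews–Warnaar series and its functional equation -/

/-- The summand of the Andrews–Warnaar series for a product of two partial theta functions, with
parameters `a` and `b = c q`. -/
def awTerm (q a c : ℂ) (n : ℕ) : ℂ :=
  q ^ n * qPoch (a * c * q ^ n) q n * qPochInf (a * q ^ n) q * qPochInf (c * q ^ (n + 1)) q *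
    qPochInf (q ^ (n + 1)) q

/-- The Andrews–Warnaar series. -/
def awSum (q a c : ℂ) : ℂ := ∑' n, awTerm q a c n

theorem norm_mul_pow_le_one {q a : ℂ} (hq : ‖q‖ < 1) (ha : ‖a‖ ≤ 1) (n : ℕ) :
    ‖a * q ^ n‖ ≤ 1 := by
  rw [norm_mul, norm_pow]
  exact mul_le_one₀ ha (by positivity) (pow_le_one₀ (norm_nonneg q) hq.le)

theorem norm_awTerm_le {q a c : ℂ} (hq : ‖q‖ < 1) (ha : ‖a‖ ≤ 1) (hc : ‖c‖ ≤ 1) (n : ℕ) :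
    ‖awTerm q a c n‖ ≤ qPochBound q ^ 4 * ‖q‖ ^ n := by
  have hac : ‖a * c‖ ≤ 1 := by
    rw [norm_mul]; exact mul_le_one₀ ha (norm_nonneg _) hc
  have h1 := norm_qPoch_le hq (norm_mul_pow_le_one hq hac n) n
  have h2 := norm_qPochInf_le hq (norm_mul_pow_le_one hq ha n)
  have h3 := norm_qPochInf_le hq (norm_mul_pow_le_one hq hc (n + 1))
  have h4 := norm_qPochInf_le hq
    (by simpa using norm_mul_pow_le_one hq (a := 1) (by simp) (n + 1) : ‖q ^ (n + 1)‖ ≤ 1)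
  have hM := (qPochBound_pos q).le
  calc ‖awTerm q a c n‖ = ‖q‖ ^ n * ‖qPoch (a * c * q ^ n) q n‖ * ‖qPochInf (a * q ^ n) q‖ *
        ‖qPochInf (c * q ^ (n + 1)) q‖ * ‖qPochInf (q ^ (n + 1)) q‖ := by
        simp [awTerm, norm_pow]
    _ ≤ ‖q‖ ^ n * qPochBound q * qPochBound q * qPochBound q * qPochBound q := by gcongr
    _ = _ := by ring

theorem summable_awTerm {q a c : ℂ} (hq : ‖q‖ < 1) (ha : ‖a‖ ≤ 1) (hc : ‖c‖ ≤ 1) :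
    Summable (awTerm q a c) :=
  .of_norm_bounded ((summable_geometric_of_lt_one (norm_nonneg q) hq).mul_left _)
    (norm_awTerm_le hq ha hc)

theorem norm_awSum_le {q a c : ℂ} (hq : ‖q‖ < 1) (ha : ‖a‖ ≤ 1) (hc : ‖c‖ ≤ 1) :
    ‖awSum q a c‖ ≤ qPochBound q ^ 4 * (1 - ‖q‖)⁻¹ :=
  tsum_of_norm_bounded ((hasSum_geometric_of_lt_one (norm_nonneg q) hq).mul_left _)
    (norm_awTerm_le hq ha hc)

/-- The four-term combination telescopes, and every factor of the closed form tends to 1 as `N`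
grows. -/
theorem awTerm_partial_sum {q : ℂ} (hq : ‖q‖ < 1) (a c : ℂ) (N : ℕ) :
    ∑ n ∈ Finset.range (N + 1), (awTerm q a c n + a * awTerm q (a * q) c n +
      c * q * awTerm q a (c * q) n + a * c * q * awTerm q (a * q) (c * q) n) =
    qPoch (a * c * q ^ (N + 2)) q N * qPochInf (a * q ^ (N + 1)) q *
      qPochInf (c * q ^ (N + 2)) q * qPochInf (q ^ (N + 1)) q := by
  induction N with
  | zero =>
    have h1 := qPochInf_step hq a
    have h2 := qPochInf_step hq (c * q)
    simp only [zero_add, Finset.range_one, Finset.sum_singleton, awTerm, qPoch_zero, pow_zero,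
      mul_one, pow_one, pow_two]
    rw [h1, h2]
    ring_nf
  | succ N ih =>
    rw [Finset.sum_range_succ, ih]
    simp only [awTerm]
    have e1 : qPochInf (a * q ^ (N + 1)) q =
        (1 - a * q ^ (N + 1)) * qPochInf (a * q ^ (N + 2)) q := by
      rw [qPochInf_step hq]; ring_nf
    have e2 : qPochInf (c * q ^ (N + 2)) q =
        (1 - c * q ^ (N + 2)) * qPochInf (c * q ^ (N + 3)) q := by
      rw [qPochInf_step hq]; ring_nf
    have e3 : qPochInf (q ^ (N + 1)) q = (1 - q ^ (N + 1)) * qPochInf (q ^ (N + 2)) q := by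
      rw [qPochInf_step hq]; ring_nf
    have p0 : qPoch (a * c * q ^ (N + 1)) q (N + 1) = (1 - a * c * q ^ (N + 1)) *
        qPoch (a * c * q ^ (N + 2)) q N := by
      rw [qPoch_succ']; ring_nf
    have p1 : qPoch (a * c * q ^ (N + 2)) q (N + 1) = qPoch (a * c * q ^ (N + 2)) q N *
        (1 - a * c * q ^ (N + 2) * q ^ N) := qPoch_succ _ _ _
    -- Both sides are `(acq^{N+2};q)_{N+2}`, split off at the first factor or at the last two.
    have p2 : (1 - a * c * q ^ (N + 2)) * qPoch (a * c * q ^ (N + 3)) q (N + 1) =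
        qPoch (a * c * q ^ (N + 2)) q N * (1 - a * c * q ^ (N + 2) * q ^ N) *
          (1 - a * c * q ^ (N + 2) * q ^ (N + 1)) := by
      rw [← p1, ← qPoch_succ, qPoch_succ' _ _ (N + 1)]; ring_nf
    have f1 : a * q * c * q ^ (N + 1) = a * c * q ^ (N + 2) := by ring
    have f2 : a * (c * q) * q ^ (N + 1) = a * c * q ^ (N + 2) := by ring
    have f3 : a * q * (c * q) * q ^ (N + 1) = a * c * q ^ (N + 3) := by ring
    have f4 : a * q * q ^ (N + 1) = a * q ^ (N + 2) := by ring
    have f5 : c * q * q ^ (N + 1 + 1) = c * q ^ (N + 3) := by ring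
    simp only [f1, f2, f3, f4, f5, p0, p1, add_assoc, Nat.reduceAdd]
    rw [e1, e2, e3]
    linear_combination (-(qPochInf (a * q ^ (N + 2)) q * qPochInf (c * q ^ (N + 3)) q *
      qPochInf (q ^ (N + 2)) q)) * p2

theorem tendsto_const_mul_pow {q : ℂ} (hq : ‖q‖ < 1) (a : ℂ) (m : ℕ) :
    Tendsto (fun N => a * q ^ (N + m)) atTop (𝓝 0) := by
  simpa using (((tendsto_pow_atTop_nhds_zero_of_norm_lt_one hq).comp
    (tendsto_add_atTop_nat m)).const_mul a)

theorem awSum_functional_equation {q a c : ℂ} (hq : ‖q‖ < 1) (ha : ‖a‖ ≤ 1) (hc : ‖c‖ ≤ 1) :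
    awSum q a c + a * awSum q (a * q) c + c * q * awSum q a (c * q) +
      a * c * q * awSum q (a * q) (c * q) = 1 := by
  have ha' : ‖a * q‖ ≤ 1 := by simpa using norm_mul_pow_le_one hq ha 1
  have hc' : ‖c * q‖ ≤ 1 := by simpa using norm_mul_pow_le_one hq hc 1
  have h := ((((summable_awTerm hq ha hc).hasSum.add
    ((summable_awTerm hq ha' hc).hasSum.mul_left a)).add
    ((summable_awTerm hq ha hc').hasSum.mul_left (c * q))).add
    ((summable_awTerm hq ha' hc').hasSum.mul_left (a * c * q))).tendsto_sum_nat
  refine tendsto_nhds_unique (h.comp (tendsto_add_atTop_nat 1)) ?_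
  simp only [Function.comp_def, awTerm_partial_sum hq]
  simpa using (((tendsto_qPoch_one hq (tendsto_const_mul_pow hq (a * c) 2) (fun N => N)).mul
    (tendsto_qPochInf_one hq (tendsto_const_mul_pow hq a 1))).mul
    (tendsto_qPochInf_one hq (tendsto_const_mul_pow hq c 2))).mul
    (tendsto_qPochInf_one hq (tendsto_const_mul_pow hq 1 1))

/-! ### Partial theta functions from iterated recurrences -/

/-- The triangular number `n (n + 1) / 2`. -/
def tri (n : ℕ) : ℕ := n * (n + 1) / 2

theorem two_mul_tri (n : ℕ) : 2 * tri n = n * (n + 1) :=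
  Nat.mul_div_cancel' (Nat.even_mul_succ_self n).two_dvd

theorem tri_zero : tri 0 = 0 := rfl

theorem tri_succ (n : ℕ) : tri (n + 1) = tri n + (n + 1) := by
  have h1 := two_mul_tri n
  have h2 := two_mul_tri (n + 1)
  nlinarith

theorem le_tri (n : ℕ) : n ≤ tri n := by
  have h := two_mul_tri n
  nlinarith [Nat.le_mul_self n]

/-- The partial theta function `∑_{n ≥ 0} (-1)^n q^{n(n+1)/2}`. -/
def partialTheta (q : ℂ) : ℂ := ∑' n : ℕ, (-1) ^ n * q ^ tri n

theorem norm_pow_tri_le {q : ℂ} (hq : ‖q‖ < 1) (n : ℕ) : ‖q‖ ^ tri n ≤ ‖q‖ ^ n :=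
  pow_le_pow_of_le_one (norm_nonneg _) hq.le (le_tri n)

theorem summable_norm_partialTheta {q : ℂ} (hq : ‖q‖ < 1) :
    Summable (fun n : ℕ => ‖(-1 : ℂ) ^ n * q ^ tri n‖) := by
  refine .of_nonneg_of_le (fun _ => norm_nonneg _) (fun n => ?_)
    (summable_geometric_of_lt_one (norm_nonneg q) hq)
  simpa using norm_pow_tri_le hq n

/-- Unrolling accumulates exponents 1 + 2 + ... + N, hence triangular numbers; boundedness of `u`
kills the remainder. -/
theorem eq_mul_partialTheta_of_recurrence {q w : ℂ} (hq : ‖q‖ < 1) {u : ℕ → ℂ} {K : ℝ}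
    (hK : ∀ n, ‖u n‖ ≤ K) (hu : ∀ n, u n + q ^ (n + 1) * u (n + 1) = w) :
    u 0 = w * partialTheta q := by
  have hfin (N : ℕ) : u 0 = w * ∑ n ∈ Finset.range N, (-1) ^ n * q ^ tri n +
      (-1) ^ N * q ^ tri N * u N := by
    induction N with
    | zero => simp [tri_zero]
    | succ N ih =>
      rw [ih, Finset.sum_range_succ, tri_succ]
      linear_combination ((-1) ^ N * q ^ tri N) * hu N
  have h1 := (summable_norm_partialTheta hq).of_norm.hasSum.tendsto_sum_nat.const_mul w
  have h2 : Tendsto (fun N => (-1) ^ N * q ^ tri N * u N) atTop (𝓝 0) := by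
    refine squeeze_zero_norm (a := fun N => ‖q‖ ^ N * K) (fun N => ?_) ?_
    · simp only [norm_mul, norm_pow, norm_neg, norm_one, one_pow, one_mul]
      exact mul_le_mul (norm_pow_tri_le hq N) (hK N) (norm_nonneg _) (by positivity)
    · simpa using (tendsto_pow_atTop_nhds_zero_of_lt_one (norm_nonneg q) hq).mul_const K
  refine tendsto_nhds_unique (tendsto_const_nhds (f := atTop (α := ℕ))) ?_
  simpa [partialTheta] using (h1.add h2).congr fun N => (hfin N).symm

/-- The functional equation pairs up as u(c) + cq u(cq) = 1 with u(c) = S(a,c) + a S(aq,c); iterate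
along c = q^j. -/
theorem awSum_add_mul_awSum {q a : ℂ} (hq : ‖q‖ < 1) (ha : ‖a‖ ≤ 1) :
    awSum q a 1 + a * awSum q (a * q) 1 = partialTheta q := by
  have ha' : ‖a * q‖ ≤ 1 := by simpa using norm_mul_pow_le_one hq ha 1
  have hp (j : ℕ) : ‖q ^ j‖ ≤ 1 := by simpa using norm_mul_pow_le_one hq (a := 1) (by simp) j
  have h := eq_mul_partialTheta_of_recurrence (w := 1) hq
    (u := fun j => awSum q a (q ^ j) + a * awSum q (a * q) (q ^ j))
    (K := qPochBound q ^ 4 * (1 - ‖q‖)⁻¹ + 1 * (qPochBound q ^ 4 * (1 - ‖q‖)⁻¹))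
    (fun j => (norm_add_le _ _).trans (add_le_add (norm_awSum_le hq ha (hp j)) (by
      rw [norm_mul]
      exact mul_le_mul ha (norm_awSum_le hq ha' (hp j)) (norm_nonneg _) zero_le_one)))
    (fun j => by
      have := awSum_functional_equation hq ha (hp j)
      rw [pow_succ]
      linear_combination this)
  simpa using h

theorem awSum_one_one_add {q : ℂ} (hq : ‖q‖ < 1) :
    awSum q 1 1 + awSum q q 1 = partialTheta q := by
  simpa using awSum_add_mul_awSum hq (a := 1) (by simp)

theorem awSum_self_one {q : ℂ} (hq : ‖q‖ < 1) : awSum q q 1 = partialTheta q ^ 2 := by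
  have hp (j : ℕ) : ‖q ^ j‖ ≤ 1 := by simpa using norm_mul_pow_le_one hq (a := 1) (by simp) j
  have h := eq_mul_partialTheta_of_recurrence (w := partialTheta q) hq
    (u := fun j => awSum q (q ^ (j + 1)) 1)
    (fun j => norm_awSum_le hq (hp _) (by simp))
    (fun j => by
      have := awSum_add_mul_awSum hq (hp (j + 1))
      rwa [← pow_succ] at this)
  simpa [pow_two] using h

/-! ### Jacobi's identity through a finite form -/

theorem qPoch_self_succ (q : ℂ) (n : ℕ) :
    qPoch q q (n + 1) = qPoch q q n * (1 - q ^ (n + 1)) := by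
  rw [qPoch_succ, pow_succ']

theorem one_sub_pow_ne_zero {q : ℂ} (hq : ‖q‖ < 1) (n : ℕ) : 1 - q ^ (n + 1) ≠ 0 := by
  intro h
  have h1 : ‖q‖ ^ (n + 1) = 1 := by rw [← norm_pow, ← sub_eq_zero.mp h, norm_one]
  exact (pow_lt_one₀ (norm_nonneg q) hq n.succ_ne_zero).ne h1

theorem qPoch_self_ne_zero {q : ℂ} (hq : ‖q‖ < 1) (n : ℕ) : qPoch q q n ≠ 0 := by
  refine Finset.prod_ne_zero_iff.mpr fun j _ => ?_
  rw [← pow_succ']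
  exact one_sub_pow_ne_zero hq j

theorem qPochInf_self_ne_zero {q : ℂ} (hq : ‖q‖ < 1) : qPochInf q q ≠ 0 := by
  have h := tprod_one_add_ne_zero_of_summable (f := fun j : ℕ => -(q * q ^ j)) (fun j => by
    rw [← sub_eq_add_neg, ← pow_succ']; exact one_sub_pow_ne_zero hq j)
    (summable_norm_mul_pow hq q)
  simpa [← sub_eq_add_neg, qPochInf] using h

/-- The coefficients of the finite form of Jacobi's identity for `(q;q)_∞^3`. -/
def jacobiCoeff (q : ℂ) (n k : ℕ) : ℂ :=
  if k ≤ n then (-1) ^ k * q ^ tri k * qPoch q q (2 * n + 1) /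
    (qPoch q q (n - k) * qPoch q q (n + 1 + k)) else 0

theorem jacobiCoeff_add (q : ℂ) (k d : ℕ) : jacobiCoeff q (k + d) k =
    (-1) ^ k * q ^ tri k * qPoch q q (2 * k + 2 * d + 1) /
      (qPoch q q d * qPoch q q (2 * k + d + 1)) := by
  rw [jacobiCoeff, if_pos (by omega)]
  rw [show 2 * (k + d) + 1 = 2 * k + 2 * d + 1 by ring, show k + d - k = d by omega,
    show k + d + 1 + k = 2 * k + d + 1 by ring]

theorem jacobiCoeff_eq_zero (q : ℂ) {n k : ℕ} (h : n < k) : jacobiCoeff q n k = 0 :=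
  if_neg (by omega)

/-- Boundary case of the recurrence below, under the antisymmetric convention that the coefficient
at -1 is minus the one at 0. -/
theorem jacobiCoeff_succ_zero {q : ℂ} (hq : ‖q‖ < 1) (n : ℕ) :
    jacobiCoeff q (n + 1) 0 = (1 + q ^ (2 * n + 2)) * jacobiCoeff q n 0 -
      q ^ (n + 1) * (jacobiCoeff q n 1 - jacobiCoeff q n 0) := by
  have hp := qPoch_self_ne_zero hq
  have hs := one_sub_pow_ne_zero hq
  rcases n with _ | d
  · rw [jacobiCoeff_eq_zero q (show 0 < 1 by omega)]
    have h1 := hs 0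
    have h2 := hs 1
    simp only [jacobiCoeff, tri_zero]
    simp [qPoch_self_succ, qPoch_zero] at h1 h2 ⊢
    field_simp
    ring
  · have a1 := jacobiCoeff_add q 0 (d + 2)
    have a2 := jacobiCoeff_add q 0 (d + 1)
    have a3 := jacobiCoeff_add q 1 d
    rw [show 0 + (d + 2) = d + 1 + 1 by ring] at a1
    rw [show 0 + (d + 1) = d + 1 by ring] at a2
    rw [show 1 + d = d + 1 by ring] at a3
    rw [a1, a2, a3]
    rw [show 2 * 0 + 2 * (d + 2) + 1 = 2 * d + 3 + 1 + 1 by ring,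
      show 2 * 0 + 2 * (d + 1) + 1 = 2 * d + 3 by ring,
      show 2 * 1 + 2 * d + 1 = 2 * d + 3 by ring,
      show 2 * 1 + d + 1 = d + 1 + 1 + 1 by ring,
      show d + 2 = d + 1 + 1 by ring]
    simp only [qPoch_self_succ, tri_succ, tri_zero]
    have h0 := hp d
    have h1 := hs d
    have h2 := hs (d + 1)
    have h3 := hs (d + 1 + 1)
    generalize qPoch q q (2 * d + 3) = P
    generalize qPoch q q d = R at *
    field_simp
    ring

/-- This is multiplication of a Laurent polynomial in x by (1 - xq^{n+1})(1 - q^{n+1}/x), read on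
coefficients. -/
theorem jacobiCoeff_succ_succ {q : ℂ} (hq : ‖q‖ < 1) (n k : ℕ) :
    jacobiCoeff q (n + 1) (k + 1) = (1 + q ^ (2 * n + 2)) * jacobiCoeff q n (k + 1) -
      q ^ (n + 1) * (jacobiCoeff q n k + jacobiCoeff q n (k + 2)) := by
  have hp := qPoch_self_ne_zero hq
  have hs := one_sub_pow_ne_zero hq
  rcases lt_or_ge n k with h | h
  · simp [jacobiCoeff_eq_zero q, h, show n < k + 1 by omega, show n < k + 2 by omega]
  obtain ⟨d, rfl⟩ := Nat.exists_eq_add_of_le h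
  have a1 := jacobiCoeff_add q (k + 1) d
  have a2 := jacobiCoeff_add q k d
  rw [show k + 1 + d = k + d + 1 by ring] at a1
  rw [a1, a2]
  -- For `d = 0` and `d = 1` some neighbouring coefficients lie beyond `n` and vanish by definition.
  rcases d with _ | _ | d
  · rw [jacobiCoeff_eq_zero q (show k + 0 < k + 1 by omega),
      jacobiCoeff_eq_zero q (show k + 0 < k + 2 by omega)]
    rw [show 2 * (k + 1) + 2 * 0 + 1 = 2 * k + 3 by ring,
      show 2 * k + 2 * 0 + 1 = 2 * k + 1 by ring]
    have h1 := hp (2 * k + 1)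
    have h2 := hp (2 * k + 3)
    simp only [qPoch_zero, tri_succ]
    field_simp
    ring
  · rw [jacobiCoeff_eq_zero q (show k + (0 + 1) < k + 2 by omega)]
    have a3 := jacobiCoeff_add q (k + 1) 0
    rw [show k + 1 + 0 = k + (0 + 1) by ring] at a3
    rw [a3]
    rw [show 2 * (k + 1) + 2 * (0 + 1) + 1 = 2 * k + 2 + 1 + 1 + 1 by ring,
      show 2 * (k + 1) + (0 + 1) + 1 = 2 * k + 2 + 1 + 1 by ring,
      show 2 * k + 2 * (0 + 1) + 1 = 2 * k + 2 + 1 by ring,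
      show 2 * k + (0 + 1) + 1 = 2 * k + 2 by ring,
      show 2 * (k + 1) + 2 * 0 + 1 = 2 * k + 2 + 1 by ring]
    simp only [qPoch_self_succ, tri_succ, qPoch_zero]
    have h0 := hp (2 * k + 2)
    have h1 := hs (2 * k + 2)
    have h2 := hs (2 * k + 2 + 1)
    have h3 := hs 0
    generalize qPoch q q (2 * k + 2) = P at *
    field_simp
    ring
  · have a3 := jacobiCoeff_add q (k + 1) (d + 1)
    have a4 := jacobiCoeff_add q (k + 2) d
    rw [show k + 1 + (d + 1) = k + (d + 1 + 1) by ring] at a3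
    rw [show k + 2 + d = k + (d + 1 + 1) by ring] at a4
    rw [a3, a4]
    rw [show 2 * (k + 1) + 2 * (d + 1 + 1) + 1 = 2 * k + 2 * d + 5 + 1 + 1 by ring,
      show 2 * (k + 1) + (d + 1 + 1) + 1 = 2 * k + d + 3 + 1 + 1 by ring,
      show 2 * k + 2 * (d + 1 + 1) + 1 = 2 * k + 2 * d + 5 by ring,
      show 2 * k + (d + 1 + 1) + 1 = 2 * k + d + 3 by ring,
      show 2 * (k + 1) + 2 * (d + 1) + 1 = 2 * k + 2 * d + 5 by ring,
      show 2 * (k + 1) + (d + 1) + 1 = 2 * k + d + 3 + 1 by ring,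
      show 2 * (k + 2) + 2 * d + 1 = 2 * k + 2 * d + 5 by ring,
      show 2 * (k + 2) + d + 1 = 2 * k + d + 3 + 1 + 1 by ring]
    simp only [qPoch_self_succ, tri_succ]
    have h0 := hp (2 * k + d + 3)
    have h1 := hs (2 * k + d + 3)
    have h2 := hs (2 * k + d + 3 + 1)
    have h3 := hs d
    have h4 := hs (d + 1)
    have h5 := hp d
    generalize qPoch q q (2 * k + 2 * d + 5) = P at *
    generalize qPoch q q (2 * k + d + 3) = S at *
    generalize qPoch q q d = R at *
    field_simp
    ring

/-- Since (2k-1) + (2k+3) = 2(2k+1), the weights 2k+1 are an eigenvector of the recurrence, with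
eigenvalue 1 + q^{2n+2} - 2q^{n+1}. The last summand is the truncation error, zero once `m > n`. -/
theorem sum_jacobiCoeff_succ {q : ℂ} (hq : ‖q‖ < 1) (n m : ℕ) :
    ∑ k ∈ Finset.range (m + 1), (2 * (k : ℂ) + 1) * jacobiCoeff q (n + 1) k =
      (1 - q ^ (n + 1)) ^ 2 *
        ∑ k ∈ Finset.range (m + 1), (2 * (k : ℂ) + 1) * jacobiCoeff q n k +
      q ^ (n + 1) * ((2 * (m : ℂ) + 3) * jacobiCoeff q n m -
        (2 * (m : ℂ) + 1) * jacobiCoeff q n (m + 1)) := by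
  induction m with
  | zero =>
    simp only [zero_add, Finset.range_one, Finset.sum_singleton, jacobiCoeff_succ_zero hq]
    push_cast
    ring
  | succ m ih =>
    rw [Finset.sum_range_succ, ih, Finset.sum_range_succ _ (m + 1), jacobiCoeff_succ_succ hq]
    push_cast
    ring

theorem sum_jacobiCoeff {q : ℂ} (hq : ‖q‖ < 1) (n : ℕ) :
    ∑ k ∈ Finset.range (n + 1), (2 * (k : ℂ) + 1) * jacobiCoeff q n k = qPoch q q n ^ 2 := by
  induction n with
  | zero =>
    have h := one_sub_pow_ne_zero hq 0
    simp only [zero_add, pow_one] at h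
    simp [jacobiCoeff, tri_zero, qPoch_self_succ, qPoch_zero, div_self h]
  | succ n ih =>
    rw [sum_jacobiCoeff_succ hq, Finset.sum_range_succ, ih,
      jacobiCoeff_eq_zero q (Nat.lt_succ_self n), jacobiCoeff_eq_zero q (by omega),
      qPoch_self_succ]
    ring

theorem tsum_jacobiCoeff {q : ℂ} (hq : ‖q‖ < 1) (n : ℕ) :
    ∑' k : ℕ, (2 * (k : ℂ) + 1) * jacobiCoeff q n k = qPoch q q n ^ 2 := by
  rw [← sum_jacobiCoeff hq]
  refine tsum_eq_sum fun k hk => ?_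
  rw [jacobiCoeff_eq_zero q (by simpa using hk), mul_zero]

theorem exists_norm_inv_qPoch_self_le {q : ℂ} (hq : ‖q‖ < 1) :
    ∃ K : ℝ, 0 ≤ K ∧ ∀ n, ‖(qPoch q q n)⁻¹‖ ≤ K := by
  have h := ((tendsto_qPoch hq q).inv₀ (qPochInf_self_ne_zero hq)).norm.bddAbove_range
  obtain ⟨K, hK⟩ := h
  have hK' (n : ℕ) : ‖(qPoch q q n)⁻¹‖ ≤ K := hK ⟨n, rfl⟩
  exact ⟨K, (norm_nonneg _).trans (hK' 0), hK'⟩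

theorem summable_jacobi_bound {q : ℂ} (hq : ‖q‖ < 1) :
    Summable (fun k : ℕ => (2 * (k : ℝ) + 1) * ‖q‖ ^ tri k) := by
  have hn : ‖‖q‖‖ < 1 := by simpa using hq
  have h := ((summable_pow_mul_geometric_of_norm_lt_one 1 hn).mul_left 2).add
    (summable_geometric_of_lt_one (norm_nonneg q) hq)
  refine .of_nonneg_of_le (fun _ => by positivity) (fun k => ?_) h
  calc (2 * (k : ℝ) + 1) * ‖q‖ ^ tri k ≤ (2 * (k : ℝ) + 1) * ‖q‖ ^ k := by
        exact mul_le_mul_of_nonneg_left (norm_pow_tri_le hq k) (by positivity)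
    _ = _ := by ring

/-- Jacobi's identity `∑_{k ≥ 0} (-1)^k (2k+1) q^{k(k+1)/2} = (q;q)_∞^3`. -/
theorem tsum_jacobi {q : ℂ} (hq : ‖q‖ < 1) :
    ∑' k : ℕ, (2 * (k : ℂ) + 1) * ((-1) ^ k * q ^ tri k) = qPochInf q q ^ 3 := by
  have hP := qPochInf_self_ne_zero hq
  obtain ⟨K, hK0, hK⟩ := exists_norm_inv_qPoch_self_le hq
  have hlim := tendsto_qPoch hq q
  -- In the limit each quotient of factorials becomes 1/(q;q)_∞, while the finite sums tend to
  -- (q;q)_∞^2.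
  have key : Tendsto (fun n => ∑' k : ℕ, (2 * (k : ℂ) + 1) * jacobiCoeff q n k) atTop
      (𝓝 (∑' k : ℕ, (2 * (k : ℂ) + 1) * ((-1) ^ k * q ^ tri k) * (qPochInf q q)⁻¹)) := by
    refine tendsto_tsum_of_dominated_convergence
      (bound := fun k => (2 * (k : ℝ) + 1) * ‖q‖ ^ tri k * (qPochBound q * K * K))
      ((summable_jacobi_bound hq).mul_right _) (fun k => ?_) (Eventually.of_forall fun n k => ?_)
    · have l1 : Tendsto (fun n => qPoch q q (2 * n + 1)) atTop (𝓝 (qPochInf q q)) :=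
        hlim.comp (tendsto_atTop_mono (fun n => by simp only [id]; omega) tendsto_id)
      have l2 : Tendsto (fun n => qPoch q q (n - k)) atTop (𝓝 (qPochInf q q)) :=
        hlim.comp (tendsto_sub_atTop_nat k)
      have l3 : Tendsto (fun n => qPoch q q (n + 1 + k)) atTop (𝓝 (qPochInf q q)) :=
        hlim.comp (tendsto_atTop_mono (fun n => by simp only [id]; omega) tendsto_id)
      have l4 := ((l1.const_mul ((-1) ^ k * q ^ tri k)).div (l2.mul l3)
        (mul_ne_zero hP hP)).const_mul (2 * (k : ℂ) + 1)
      have e : (2 * (k : ℂ) + 1) * ((-1) ^ k * q ^ tri k * qPochInf q q /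
          (qPochInf q q * qPochInf q q)) =
          (2 * (k : ℂ) + 1) * ((-1) ^ k * q ^ tri k) * (qPochInf q q)⁻¹ := by
        field_simp
      rw [e] at l4
      refine l4.congr' ?_
      filter_upwards [eventually_ge_atTop k] with n hn
      simp [jacobiCoeff, hn]
    · have hk : ‖2 * (k : ℂ) + 1‖ = 2 * (k : ℝ) + 1 := by
        have : (2 * (k : ℂ) + 1) = ((2 * k + 1 : ℕ) : ℂ) := by push_cast; ring
        rw [this, Complex.norm_natCast]; push_cast; ring
      have hM := (qPochBound_pos q).le
      rw [norm_mul, hk, mul_assoc (2 * (k : ℝ) + 1)]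
      refine mul_le_mul_of_nonneg_left ?_ (by positivity)
      unfold jacobiCoeff
      split_ifs
      · rw [div_eq_mul_inv, mul_inv]
        simp only [norm_mul, norm_pow, norm_neg, norm_one, one_pow, one_mul]
        have b1 := norm_qPoch_le hq hq.le (2 * n + 1)
        have b2 := hK (n - k)
        have b3 := hK (n + 1 + k)
        rw [mul_assoc, mul_assoc]
        gcongr
      · rw [norm_zero]; positivity
  simp only [tsum_jacobiCoeff hq, tsum_mul_right] at key
  have := tendsto_nhds_unique key (hlim.pow 2)
  rw [mul_inv_eq_iff_eq_mul₀ hP] at this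
  rw [this]
  ring

/-! ### Closed form of the defining series -/

theorem HasSum.of_eq {ι : Type*} {f g : ι → ℂ} {a b : ℂ} (h : HasSum f a) (hfg : ∀ i, g i = f i)
    (hab : b = a) : HasSum g b := by
  rw [hab, funext hfg]
  exact h

theorem summable_norm_partialTheta_weighted {q : ℂ} (hq : ‖q‖ < 1) :
    Summable (fun n : ℕ => ‖(-1 : ℂ) ^ n * ((n : ℂ) + 1) * q ^ tri n‖) := by
  refine .of_nonneg_of_le (fun _ => norm_nonneg _) (fun n => ?_) (summable_jacobi_bound hq)
  have hn : ‖(n : ℂ) + 1‖ = (n : ℝ) + 1 := by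
    rw [← Nat.cast_add_one, Complex.norm_natCast, Nat.cast_add_one]
  simp only [norm_mul, norm_pow, norm_neg, norm_one, one_pow, one_mul, hn]
  gcongr
  linarith [Nat.cast_nonneg (α := ℝ) n]

/-- Split 2(n+1) = 1 + (2n+1) and apply Jacobi's identity. -/
theorem two_mul_tsum_partialTheta_weighted {q : ℂ} (hq : ‖q‖ < 1) :
    2 * ∑' n : ℕ, (-1 : ℂ) ^ n * ((n : ℂ) + 1) * q ^ tri n =
      partialTheta q + qPochInf q q ^ 3 := by
  have h := ((summable_norm_partialTheta_weighted hq).of_norm.hasSum.mul_left 2).sub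
    (summable_norm_partialTheta hq).of_norm.hasSum
  have h2 := h.tsum_eq
  rw [partialTheta, ← tsum_jacobi hq, ← sub_eq_iff_eq_add', ← h2]
  exact tsum_congr fun n => by ring

/-- Over a common factor the two terms carry 1 + q^n and 1 - q^n, whose difference 2q^n supplies the
second power of q^n. -/
theorem dTerm_eq_awTerm {q : ℂ} (hq : ‖q‖ < 1) (n : ℕ+) :
    dTerm q n = (awTerm q q 1 n - awTerm q 1 1 n) / 2 := by
  obtain ⟨m, hm⟩ := Nat.exists_eq_succ_of_ne_zero n.ne_zero
  have e1 : qPochInf (q ^ (n : ℕ)) q = (1 - q ^ (n : ℕ)) * qPochInf (q ^ ((n : ℕ) + 1)) q := by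
    rw [qPochInf_step hq, pow_succ]
  have hne : 1 - q ^ (n : ℕ) ≠ 0 := by rw [hm]; exact one_sub_pow_ne_zero hq m
  have e2 : qPoch (q ^ ((n : ℕ) + 1)) q n = (1 + q ^ (n : ℕ)) * qPoch (q ^ (n : ℕ)) q n := by
    refine mul_left_cancel₀ hne ?_
    have h1 := qPoch_succ' (q ^ (n : ℕ)) q n
    have h2 := qPoch_succ (q ^ (n : ℕ)) q n
    rw [← pow_succ] at h1
    rw [← h1, h2]
    ring
  simp only [dTerm, awTerm, one_mul, mul_one, ← pow_succ', e1, e2]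
  ring

theorem hasSum_dTerm {q : ℂ} (hq : ‖q‖ < 1) :
    HasSum (dTerm q) (partialTheta q ^ 2 -
      ∑' n : ℕ, (-1 : ℂ) ^ n * ((n : ℂ) + 1) * q ^ tri n) := by
  have h1 : HasSum (awTerm q q 1) (awSum q q 1) := (summable_awTerm hq hq.le (by simp)).hasSum
  have h2 : HasSum (awTerm q 1 1) (awSum q 1 1) :=
    (summable_awTerm hq (by simp) (by simp)).hasSum
  have h3 := (h1.sub h2).div_const 2
  rw [show dTerm q = fun n : ℕ+ => (awTerm q q 1 n - awTerm q 1 1 n) / 2 from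
    funext (dTerm_eq_awTerm hq)]
  rw [hasSum_pnat_iff (f := fun n : ℕ => (awTerm q q 1 n - awTerm q 1 1 n) / 2)]
  refine h3.of_eq (fun _ => rfl) ?_
  -- Passing from ℕ to ℕ+ removes the term at 0, equal to (q;q)_∞^3 / 2.
  have e0 : qPochInf 1 q = 0 := by rw [qPochInf_step hq]; simp
  have e1 : awTerm q 1 1 0 = 0 := by simp [awTerm, e0]
  have e2 : awTerm q q 1 0 = qPochInf q q ^ 3 := by
    simp [awTerm, qPoch_zero]; ring
  have e3 := awSum_one_one_add hq
  have e4 := awSum_self_one hq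
  have e5 := two_mul_tsum_partialTheta_weighted hq
  rw [e1, e2]
  linear_combination -(1 / 2 : ℂ) * e5 - e4 + (1 / 2 : ℂ) * e3

/-! ### Integer coefficients -/

/-- The sum of the weights `w` over the fibre of `e` at `n`. -/
def fiberSum {ι : Type*} (e : ι → ℕ) (w : ι → ℤ) (n : ℕ) : ℤ := ∑' i : e ⁻¹' {n}, w i

theorem hasSum_fiberSum {ι : Type*} {e : ι → ℕ} {w : ι → ℤ} (he : ∀ n, (e ⁻¹' {n}).Finite)
    {q : ℂ} (hs : Summable (fun i => (w i : ℂ) * q ^ e i)) :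
    HasSum (fun n => (fiberSum e w n : ℂ) * q ^ n) (∑' i, (w i : ℂ) * q ^ e i) := by
  refine (hs.hasSum.tsum_fiberwise e).of_eq (fun n => ?_) rfl
  have := (he n).fintype
  rw [fiberSum, tsum_fintype, tsum_fintype, Int.cast_sum, Finset.sum_mul]
  refine Finset.sum_congr rfl fun i _ => ?_
  rw [show e i = n from i.2]

theorem finite_tri_fiber (n : ℕ) : (tri ⁻¹' {n}).Finite :=
  (Set.finite_Iic n).subset fun k hk => (le_tri k).trans (le_of_eq hk)

theorem finite_tri_add_tri_fiber (n : ℕ) :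
    ((fun p : ℕ × ℕ => tri p.1 + tri p.2) ⁻¹' {n}).Finite := by
  refine ((Set.finite_Iic n).prod (Set.finite_Iic n)).subset fun p hp => ?_
  have h1 := le_tri p.1
  have h2 := le_tri p.2
  simp only [Set.mem_preimage, Set.mem_singleton_iff] at hp
  simp only [Set.mem_prod, Set.mem_Iic]
  omega

/-- The coefficients of `∑_{n ≥ 1} q^{2n} (q^{n+1};q)_∞^3 (q^n;q)_n`. -/
def dCoeff (n : ℕ) : ℤ :=
  fiberSum (fun p : ℕ × ℕ => tri p.1 + tri p.2) (fun p => (-1) ^ p.1 * (-1) ^ p.2) n -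
    fiberSum tri (fun k => (-1) ^ k * (k + 1)) n

theorem hasSum_partialTheta_sq {q : ℂ} (hq : ‖q‖ < 1) :
    HasSum (fun p : ℕ × ℕ => ((-1) ^ p.1 * q ^ tri p.1) * ((-1) ^ p.2 * q ^ tri p.2))
      (partialTheta q ^ 2) := by
  have h := summable_norm_partialTheta hq
  rw [pow_two, partialTheta, tsum_mul_tsum_of_summable_norm h h]
  exact (summable_mul_of_summable_norm h h).hasSum

theorem hasSum_dCoeff_nat {q : ℂ} (hq : ‖q‖ < 1) :
    HasSum (fun n : ℕ => (dCoeff n : ℂ) * q ^ n) (∑' n : ℕ+, dTerm q n) := by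
  have h1 := hasSum_partialTheta_sq hq
  have e1 : (fun p : ℕ × ℕ => ((-1 : ℂ) ^ p.1 * q ^ tri p.1) * ((-1) ^ p.2 * q ^ tri p.2)) =
      fun p => (((-1) ^ p.1 * (-1) ^ p.2 : ℤ) : ℂ) * q ^ (tri p.1 + tri p.2) := by
    ext p; push_cast; ring
  rw [e1] at h1
  have h2 := (summable_norm_partialTheta_weighted hq).of_norm.hasSum
  have e2 : (fun n : ℕ => (-1 : ℂ) ^ n * ((n : ℂ) + 1) * q ^ tri n) =
      fun n : ℕ => (((-1) ^ n * (n + 1) : ℤ) : ℂ) * q ^ tri n := by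
    ext n; push_cast; ring
  rw [(hasSum_dTerm hq).tsum_eq, e2]
  rw [e2] at h2
  have h3 := (hasSum_fiberSum finite_tri_add_tri_fiber h1.summable).sub
    (hasSum_fiberSum finite_tri_fiber h2.summable)
  rw [h1.tsum_eq] at h3
  refine h3.of_eq (fun n => ?_) rfl
  rw [dCoeff]
  push_cast
  ring

/-- At q = 0 the power series reduces to its constant term, and every `dTerm` vanishes. -/
theorem dCoeff_zero : dCoeff 0 = 0 := by
  have h1 := hasSum_dCoeff_nat (q := 0) (by simp)
  have h2 := hasSum_single (f := fun n : ℕ => (dCoeff n : ℂ) * 0 ^ n) 0 (fun n hn => by simp [hn])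
  have h3 : ∑' n : ℕ+, dTerm 0 n = 0 := by simp [dTerm]
  rw [h3] at h1
  simpa using h2.unique h1

theorem isDSeq_dCoeff : IsDSeq (fun n : ℕ+ => (dCoeff n : ℂ)) := by
  intro q hq
  rw [hasSum_pnat_iff (f := fun n : ℕ => (dCoeff n : ℂ) * q ^ n)]
  simpa [dCoeff_zero] using hasSum_dCoeff_nat hq

/-! ### Uniqueness of the coefficients -/

/-- The extension of a sequence on the positive integers by the value `0` at `0`. -/
def extendZero (D : ℕ+ → ℂ) (n : ℕ) : ℂ := if h : 0 < n then D ⟨n, h⟩ else 0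

theorem extendZero_coe (D : ℕ+ → ℂ) (n : ℕ+) : extendZero D n = D n := dif_pos n.pos

theorem extendZero_zero (D : ℕ+ → ℂ) : extendZero D 0 = 0 := rfl

theorem IsDSeq.hasFPowerSeriesAt {D : ℕ+ → ℂ} (hD : IsDSeq D) :
    HasFPowerSeriesAt (fun q => ∑' n : ℕ+, dTerm q n)
      (FormalMultilinearSeries.ofScalars ℂ (extendZero D)) 0 := by
  rw [hasFPowerSeriesAt_iff]
  filter_upwards [Metric.ball_mem_nhds (0 : ℂ) one_pos] with q hq
  have h := hD q (by simpa using hq)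
  have h2 : HasSum (fun n : ℕ+ => extendZero D n * q ^ (n : ℕ)) (∑' n : ℕ+, dTerm q n) := by
    simpa only [extendZero_coe] using h
  rw [hasSum_pnat_iff (f := fun n : ℕ => extendZero D n * q ^ n)] at h2
  simpa [extendZero_zero, mul_comm, FormalMultilinearSeries.coeff_ofScalars] using h2

theorem IsDSeq.unique {D₁ D₂ : ℕ+ → ℂ} (h₁ : IsDSeq D₁) (h₂ : IsDSeq D₂) : D₁ = D₂ := by
  have h := h₁.hasFPowerSeriesAt.eq_formalMultilinearSeries h₂.hasFPowerSeriesAt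
  ext n
  have hn := congrArg (fun p => p.coeff (n : ℕ)) h
  simpa [extendZero_coe, FormalMultilinearSeries.coeff_ofScalars] using hn

/-! ### Folding a symmetric double series, and the final identity -/

theorem hasSum_ite_of_injective {α β : Type*} {f : β → ℂ} {g : α → β} (hg : Function.Injective g)
    (P : β → Prop) [DecidablePred P] (hP : ∀ b, P b ↔ b ∈ Set.range g) (hf : Summable f) :
    HasSum (fun b => if P b then f b else 0) (∑' a, f (g a)) := by
  rw [← hg.hasSum_iff fun b hb => if_neg (mt (hP b).mp hb)]
  have : (fun b => if P b then f b else 0) ∘ g = f ∘ g := by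
    ext a
    simp [(hP (g a)).mpr ⟨a, rfl⟩]
  rw [this]
  exact (hf.comp_injective hg).hasSum

/-- The regions r ≤ s and s ≤ r cover the quadrant, meet in the diagonal, and have equal sums by
symmetry. -/
theorem tsum_add_tsum_diag {F : ℕ × ℕ → ℂ} (hF : Summable F) (hsymm : ∀ r s, F (r, s) = F (s, r)) :
    ∑' p, F p + ∑' r, F (r, r) = 2 * ∑' p : ℕ × ℕ, F (p.1, p.1 + p.2) := by
  have hD := hasSum_ite_of_injective (g := fun r : ℕ => (r, r)) (fun a b h => by simpa using h)
    (fun p : ℕ × ℕ => p.1 = p.2) (fun p => ⟨fun h => ⟨p.1, Prod.ext rfl h⟩, by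
      rintro ⟨r, rfl⟩; rfl⟩) hF
  have hU := hasSum_ite_of_injective (g := fun p : ℕ × ℕ => (p.1, p.1 + p.2))
    (fun a b h => by
      simp only [Prod.mk.injEq] at h
      exact Prod.ext h.1 (by omega))
    (fun p : ℕ × ℕ => p.1 ≤ p.2) (fun p => ⟨fun h => ⟨(p.1, p.2 - p.1), Prod.ext rfl (by
      simp only; omega)⟩, by rintro ⟨r, rfl⟩; simp⟩) hF
  have hV := hasSum_ite_of_injective (g := fun p : ℕ × ℕ => (p.1 + p.2, p.1))
    (fun a b h => by
      simp only [Prod.mk.injEq] at h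
      exact Prod.ext h.2 (by omega))
    (fun p : ℕ × ℕ => p.2 ≤ p.1) (fun p => ⟨fun h => ⟨(p.2, p.1 - p.2), Prod.ext (by
      simp only; omega) rfl⟩, by rintro ⟨r, rfl⟩; simp⟩) hF
  have h1 := (hF.hasSum.add hD).unique (by
    convert hU.add hV using 2 with p
    rcases lt_trichotomy p.1 p.2 with h | h | h
    · simp [h.le, h.ne, not_le.mpr h]
    · simp [h]
    · simp [h.le, h.ne', not_le.mpr h])
  rw [h1, two_mul]
  congr 1
  exact tsum_congr fun p => hsymm _ _

end

theorem theorem6 :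
    -- the products and the series that define the sequence converge for `|q| < 1`
    (∀ q : ℂ, ‖q‖ < 1 →
      (∀ n : ℕ+, Multipliable (fun j : ℕ => 1 - q ^ ((n : ℕ) + 1) * q ^ j)) ∧
      Summable (fun n : ℕ+ => dTerm q n)) ∧
    -- the sequence exists, is unique, and consists of integers
    (∃! D' : ℕ+ → ℤ, IsDSeq (fun n => (D' n : ℂ))) ∧
    -- the identity, with all its series convergent
    (∀ D' : ℕ+ → ℂ, IsDSeq D' → ∀ q : ℂ, ‖q‖ < 1 →
      Summable (fun p : ℕ × ℕ =>
        (-1 : ℂ) ^ p.2 * q ^ ((2 * p.1 + 1) ^ 2 + (2 * p.1 + 1 + 2 * p.2) ^ 2)) ∧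
      Summable (fun n : ℕ => (-1 : ℂ) ^ n * ((n : ℂ) + 1) * q ^ (1 + (2 * n + 1) ^ 2)) ∧
      Summable (fun n : ℕ => q ^ (2 * (2 * n + 1) ^ 2)) ∧
      HasSum (fun n : ℕ+ => D' n * q ^ (8 * (n : ℕ) + 2))
        (2 * (∑' p : ℕ × ℕ,
            (-1 : ℂ) ^ p.2 * q ^ ((2 * p.1 + 1) ^ 2 + (2 * p.1 + 1 + 2 * p.2) ^ 2))
          - (∑' n : ℕ, (-1 : ℂ) ^ n * ((n : ℂ) + 1) * q ^ (1 + (2 * n + 1) ^ 2))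
          - ∑' n : ℕ, q ^ (2 * (2 * n + 1) ^ 2))) := by
  refine ⟨fun q hq => ⟨fun n => multipliable_qPochInf hq _, (hasSum_dTerm hq).summable⟩,
    ⟨fun n => dCoeff n, isDSeq_dCoeff, fun D hD => ?_⟩, fun D hD q hq => ?_⟩
  · ext n
    exact_mod_cast congrFun (hD.unique isDSeq_dCoeff) n
  have hx : ‖q ^ 8‖ < 1 := by
    rw [norm_pow]; exact pow_lt_one₀ (norm_nonneg q) hq (by norm_num)
  -- This explains the base `q ^ 8`; two odd squares, or one plus 1, leave the prefactor `q ^ 2`.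
  have ht (n : ℕ) : (2 * n + 1) ^ 2 = 8 * tri n + 1 := by linarith [two_mul_tri n]
  set F : ℕ × ℕ → ℂ := fun p =>
    ((-1) ^ p.1 * (q ^ 8) ^ tri p.1) * ((-1) ^ p.2 * (q ^ 8) ^ tri p.2) with hF
  have hFs : HasSum F (partialTheta (q ^ 8) ^ 2) := hasSum_partialTheta_sq hx
  have e1 : (fun p : ℕ × ℕ =>
      (-1 : ℂ) ^ p.2 * q ^ ((2 * p.1 + 1) ^ 2 + (2 * p.1 + 1 + 2 * p.2) ^ 2)) =
      fun p => q ^ 2 * F (p.1, p.1 + p.2) := by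
    ext p
    have hs : (-1 : ℂ) ^ p.1 * (-1) ^ p.1 = 1 := by rw [← mul_pow]; simp
    rw [show 2 * p.1 + 1 + 2 * p.2 = 2 * (p.1 + p.2) + 1 by ring, ht, ht]
    simp only [hF, ← pow_mul]
    rw [pow_add (-1 : ℂ)]
    linear_combination (-(-1) ^ p.2 * q ^ (8 * tri p.1 + 1 + (8 * tri (p.1 + p.2) + 1))) * hs
  have e2 : (fun n : ℕ => (-1 : ℂ) ^ n * ((n : ℂ) + 1) * q ^ (1 + (2 * n + 1) ^ 2)) =
      fun n : ℕ => q ^ 2 * ((-1 : ℂ) ^ n * ((n : ℂ) + 1) * (q ^ 8) ^ tri n) := by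
    ext n
    rw [ht, ← pow_mul]
    ring
  have e3 : (fun n : ℕ => q ^ (2 * (2 * n + 1) ^ 2)) = fun n : ℕ => q ^ 2 * F (n, n) := by
    ext n
    have hs : (-1 : ℂ) ^ n * (-1) ^ n = 1 := by rw [← mul_pow]; simp
    rw [ht]
    simp only [hF, ← pow_mul]
    linear_combination (-q ^ (2 * (8 * tri n + 1))) * hs
  rw [e1, e2, e3]
  refine ⟨(hFs.summable.comp_injective (i := fun p : ℕ × ℕ => (p.1, p.1 + p.2))
    fun a b h => ?_).mul_left _, (summable_norm_partialTheta_weighted hx).of_norm.mul_left _,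
    (hFs.summable.comp_injective (i := fun n : ℕ => (n, n)) fun a b h => ?_).mul_left _, ?_⟩
  · simp only [Prod.mk.injEq] at h
    exact Prod.ext h.1 (by omega)
  · simpa using h
  have h1 := (hD (q ^ 8) hx).mul_left (q ^ 2)
  rw [(hasSum_dTerm hx).tsum_eq] at h1
  have h2 := tsum_add_tsum_diag hFs.summable fun r s => mul_comm _ _
  rw [hFs.tsum_eq] at h2
  simp only [tsum_mul_left]
  refine h1.of_eq (fun n => ?_) ?_
  · rw [← pow_mul]
    ring
  · linear_combination (-q ^ 2) * h2
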